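/- Fix an optimal partial computable conditional decompressor $U$ (i.e. $U(p,y)$ is partial computable and for every partial computable $V(p,y)$ there is a constant $k$ such that $V(p,y)=x$ implies $U(q,y)=x$ for some $q$ with $|q|\le|p|+k$). Let $C(x\mid y)$ be the length of a shortest binary string $p$ with $U(p,y)=x$, and let $C(x)=C(x\mid\text{empty string})$ (conditional and plain Kolmogorov complexity). Write $\log=\log_2$. For every $n$ let $E_n\subseteq\{0,1\}^n\times\{0,1\}^n$ be (the edge set of) a bipartite graph, and suppose that there is an algorithm that computes $E_n$ given $n$. Let $\alpha,\beta,\gamma$ be positive rational numbers, and let $R_n(\alpha,\beta)$ be the maximum number of edges of $E_n$ in a rectangle $X'\times Y'$, where $X',Y'\subseteq\{0,1\}^n$, $|X'|\le 2^{\alpha n}$ and $|Y'|\le 2^{\beta n}$. Call $E_n$ edge-transitive if for any two edges $(x,y),(x',y')\in E_n$ there are permutations $\sigma,\tau$ of $\{0,1\}^n$ such that $(u,v)\in E_n\iff(\sigma(u),\tau(v))\in E_n$ for all $u,v$, and $(\sigma(x),\tau(y))=(x',y')$. Then there is a constant $d>0$ such that both of the following hold. (1) For every $\varepsilon>0$ and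 all sufficiently large $n$: if $R_n(\alpha,\beta)\cdot2^{\gamma n}\le|E_n|$, then for all but at most $\varepsilon|E_n|$ of the edges $(x,y)\in E_n$ there is no binary string $c$ such that $$C(c)<\gamma n-d\log n,\qquad C(x\mid c)<\alpha n-d\log n,\qquad C(y\mid c)<\beta n-d\log n.$$ (2) For all sufficiently large $n$: if $E_n$ is edge-transitive and $R_n(\alpha,\beta)\cdot2^{\gamma n}\ge|E_n|$, then for every edge $(x,y)\in E_n$ there is a binary string $c$ such that $$C(c)<\gamma n+d\log n,\qquad C(x\mid c)<\alpha n+d\log n,\qquad C(y\mid c)<\beta n+d\log n.$$ -/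

import Mathlib

/-! ### Plain and conditional Kolmogorov complexity -/

/-- `U p y` is the output, if any, of the decompressor `U` on the program `p` and the condition `y`.
`U` is optimal if it is partial computable and, up to an additive constant, every string has
descriptions at least as short as with any other partial computable decompressor `V`. -/
def IsOptimalDecompressor (U : List Bool → List Bool →. List Bool) : Prop :=
  Partrec₂ U ∧
    ∀ V : List Bool → List Bool →. List Bool, Partrec₂ V →
      ∃ k : ℕ, ∀ p y x : List Bool, x ∈ V p y → ∃ q : List Bool, x ∈ U q y ∧ q.length ≤ p.length + k

/-- Optimal decompressors exist. -/
theorem exists_isOptimalDecompressor :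
    ∃ U : List Bool → List Bool →. List Bool, IsOptimalDecompressor U := by
  let idx : List Bool → ℕ := fun p => p.findIdx (fun b => !b)
  let U : List Bool → List Bool →. List Bool := fun p y =>
    ((Denumerable.ofNat Nat.Partrec.Code (idx p)).eval
        (Encodable.encode (p.drop (idx p + 1), y))).bind
      (fun m => (Encodable.decode (α := List Bool) m : Part (List Bool)))
  have hidx : Computable idx :=
    (Primrec.list_findIdx (f := fun p : List Bool => p) (p := fun _ b => !b) Primrec.id
      (Primrec.not.comp Primrec.snd).to₂).to_comp
  refine ⟨U, ?_, ?_⟩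
  · refine Partrec.bind (Nat.Partrec.Code.eval_part.comp
      ((Computable.ofNat _).comp (hidx.comp Computable.fst))
      (Computable.encode.comp (Computable.pair
        (Primrec.list_drop.to_comp.comp (Computable.succ.comp (hidx.comp Computable.fst))
          Computable.fst) Computable.snd))) ?_
    exact (Computable.ofOption Computable.decode).comp Computable.snd
  · intro V hV
    obtain ⟨c, hc⟩ := Nat.Partrec.Code.exists_code.1 hV
    refine ⟨Encodable.encode c + 1, fun p y x hx =>
      ⟨List.replicate (Encodable.encode c) true ++ false :: p, ?_, ?_⟩⟩
    · have h1 : idx (List.replicate (Encodable.encode c) true ++ false :: p)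
          = Encodable.encode c := by
        have h0 : ∀ m : ℕ, (List.replicate m true ++ false :: p).findIdx (fun b => !b) = m := by
          intro m
          induction m with
          | zero => simp [List.findIdx_cons]
          | succ m ih => simp [List.replicate_succ, List.findIdx_cons, ih]
        exact h0 _
      have h2 : (List.replicate (Encodable.encode c) true ++ false :: p).drop
          (Encodable.encode c + 1) = p := by
        simp [List.drop_append]
      simp only [U, h1, h2, Denumerable.ofNat_encode, hc, Part.mem_bind_iff]
      exact ⟨Encodable.encode x, by simpa using hx, by simp⟩
    · simp; omega

/-- The conditional complexity `C(x | y)` with respect to `U`: the least length of a program that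
outputs `x` on the condition `y`. -/
noncomputable def condComplexity (U : List Bool → List Bool →. List Bool) (x y : List Bool) : ℕ :=
  sInf {l : ℕ | ∃ p : List Bool, x ∈ U p y ∧ p.length = l}

/-- The plain complexity `C(x)`: the condition is the empty string. -/
noncomputable def plainComplexity (U : List Bool → List Bool →. List Bool) (x : List Bool) : ℕ :=
  condComplexity U x []

/-- For an optimal `U` the infimum that defines the complexity is over a nonempty set. -/
theorem IsOptimalDecompressor.exists_program {U : List Bool → List Bool →. List Bool}
    (hU : IsOptimalDecompressor U) (x y : List Bool) :
    ∃ p : List Bool, x ∈ U p y ∧ p.length = condComplexity U x y := by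
  have hV : Partrec₂ (fun p _ => Part.some p : List Bool → List Bool →. List Bool) :=
    Computable.fst.partrec
  obtain ⟨k, hk⟩ := hU.2 _ hV
  obtain ⟨q, hq, -⟩ := hk x y x (Part.mem_some x)
  exact Nat.sInf_mem (s := {l : ℕ | ∃ p : List Bool, x ∈ U p y ∧ p.length = l}) ⟨_, q, hq, rfl⟩

/-! ### Bipartite graphs, given by their finite edge sets `E ⊆ X × Y` -/

open Classical in
/-- `R_E(a, b)`: the maximal number of edges of `E` in a combinatorial rectangle `X' × Y'`
with `|X'| ≤ 2 ^ a` and `|Y'| ≤ 2 ^ b`. -/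
noncomputable def maxEdgesInRectangle {X Y : Type*} [Fintype X] [Fintype Y]
    (E : Finset (X × Y)) (a b : ℝ) : ℕ :=
  ((Finset.univ : Finset (Finset X × Finset Y)).filter
      (fun R => (R.1.card : ℝ) ≤ (2 : ℝ) ^ a ∧ (R.2.card : ℝ) ≤ (2 : ℝ) ^ b)).sup
    (fun R => (E.filter (fun e => e.1 ∈ R.1 ∧ e.2 ∈ R.2)).card)

/-- Every edge is mapped to every other edge by some automorphism, that is, by a pair of
permutations of the two parts that preserves the set of edges. -/
def IsEdgeTransitive {X Y : Type*} (E : Finset (X × Y)) : Prop :=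
  ∀ e ∈ E, ∀ e' ∈ E, ∃ (σ : Equiv.Perm X) (τ : Equiv.Perm Y),
    (∀ x y, (σ x, τ y) ∈ E ↔ (x, y) ∈ E) ∧ (σ e.1, τ e.2) = e'

/-- There is an algorithm that on input `n` outputs the list of all edges of `E n`. -/
def IsComputableGraphFamily
    (E : (n : ℕ) → Finset (List.Vector Bool n × List.Vector Bool n)) : Prop :=
  ∃ L : ℕ → List (List Bool × List Bool), Computable L ∧
    ∀ (n : ℕ) (p : List Bool × List Bool),
      p ∈ L n ↔ ∃ e ∈ E n, p = (e.1.toList, e.2.toList)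

/-! Part (1) is counting. For a fixed `c`, the pairs whose two ends are simple given `c` form a
rectangle with sides at most `2 ^ (α n)` and `2 ^ (β n)`, so it holds at most `R_n` edges. There are
at most `2 ^ (γ n - d log n + 1)` simple `c`, so at most `R_n * 2 ^ (γ n) * 2 / n ^ d` edges are
bad, a vanishing fraction of `|E_n|` (`card_edges_le`).

For part (2), take a rectangle with `R_n` edges. By edge-transitivity a random automorphic image of
it contains any given edge with probability `R_n / |E_n| ≥ 2 ^ (-γ n)`, so about `2 ^ (γ n) * ln
|E_n|` images cover all edges, and `ln |E_n| < 2 n` (`exists_list_translates_cover`,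
`exists_isListCover`). Once a cover with these parameters exists, exhaustive search finds one from
`n` alone; neither the automorphisms nor `R_n` need be computed. The string `c` encodes a rectangle
of this cover that contains `(x, y)`: it costs its position in the cover plus `O(log n)` bits for
`n`, and `x`, `y` cost their positions in its sides. -/

/-! ### Covering by translates under a transitive action -/

section Cover

variable {G Ω : Type*} [Group G] [MulAction G Ω] [MulAction.IsPretransitive G Ω]

-- If `t = a • o` and `s = b • o`, then `g ↦ b⁻¹ * g * a` is a bijection onto the stabilizer of `o`.
open Classical in
theorem card_filter_smul_eq [Fintype G] (t s o : Ω) :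
    (Finset.univ.filter (fun g : G => g • t = s)).card
      = (Finset.univ.filter (fun g : G => g • o = o)).card := by
  obtain ⟨a, rfl⟩ := MulAction.exists_smul_eq G o t
  obtain ⟨b, rfl⟩ := MulAction.exists_smul_eq G o s
  refine Finset.card_equiv ((Equiv.mulRight a).trans (Equiv.mulLeft b⁻¹)) fun g => ?_
  simp [mul_smul, inv_smul_eq_iff]

open Classical in
theorem card_mul_card_filter_smul_eq [Fintype G] [Fintype Ω] (t s : Ω) :
    Fintype.card Ω * (Finset.univ.filter (fun g : G => g • t = s)).card = Fintype.card G := by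
  have h := Finset.card_eq_sum_card_fiberwise (f := fun g : G => g • t)
    (s := Finset.univ) (t := (Finset.univ : Finset Ω)) (fun _ _ => by simp)
  rw [Finset.card_univ] at h
  rw [h, Finset.sum_congr rfl fun u _ => (card_filter_smul_eq (G := G) t u t),
    card_filter_smul_eq (G := G) t s t]
  simp

open Classical in
/-- Some translate of `T` meets `S` at least as much as the average translate does. -/
theorem exists_card_mul_card_le [Fintype G] [Fintype Ω] (S T : Finset Ω) :
    ∃ g : G, S.card * T.card ≤ Fintype.card Ω * (S.filter (fun s => g⁻¹ • s ∈ T)).card := by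
  by_contra! h
  have hsum : ∑ g : G, Fintype.card Ω * (S.filter (fun s => g⁻¹ • s ∈ T)).card
      < ∑ _g : G, S.card * T.card :=
    Finset.sum_lt_sum_of_nonempty ⟨1, Finset.mem_univ _⟩ fun g _ => h g
  -- Double counting of the triples `(g, s, t)` with `g • t = s`.
  have hcount : ∑ g : G, (S.filter (fun s => g⁻¹ • s ∈ T)).card
      = ∑ s ∈ S, ∑ t ∈ T, (Finset.univ.filter (fun g : G => g • t = s)).card := by
    simp only [Finset.card_filter]
    rw [Finset.sum_comm]
    refine Finset.sum_congr rfl fun s _ => ?_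
    rw [Finset.sum_comm]
    refine Finset.sum_congr rfl fun g _ => ?_
    simp [← eq_inv_smul_iff]
  rw [← Finset.mul_sum, hcount, Finset.mul_sum] at hsum
  simp only [Finset.mul_sum, card_mul_card_filter_smul_eq] at hsum
  simp only [Finset.sum_const, smul_eq_mul, Finset.card_univ] at hsum
  exact absurd hsum (by rw [← mul_assoc, mul_comm]; simp)

-- Greedy choice: by averaging, some translate covers at least the fraction `|T| / |Ω|` of the
-- points still uncovered.
open Classical in
theorem exists_list_card_uncovered_le [Finite G] [Fintype Ω] (T : Finset Ω) (k : ℕ) :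
    ∃ l : List G, l.length = k ∧
      ((Finset.univ.filter (fun s : Ω => ∀ g ∈ l, g⁻¹ • s ∉ T)).card : ℝ)
        ≤ Fintype.card Ω * (1 - (T.card : ℝ) / Fintype.card Ω) ^ k := by
  have := Fintype.ofFinite G
  induction k with
  | zero => exact ⟨[], rfl, by simp⟩
  | succ k ih =>
    obtain ⟨l, hl, hb⟩ := ih
    set S := Finset.univ.filter (fun s : Ω => ∀ g ∈ l, g⁻¹ • s ∉ T) with hS
    have hS' : (S.card : ℝ) ≤ Fintype.card Ω * (1 - (T.card : ℝ) / Fintype.card Ω) ^ k := by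
      rw [hS]
      convert hb
    obtain ⟨g, hg⟩ := exists_card_mul_card_le (G := G) S T
    refine ⟨g :: l, by simp [hl], ?_⟩
    have hsplit : (Finset.univ.filter (fun s : Ω => ∀ h ∈ g :: l, h⁻¹ • s ∉ T))
        = S.filter (fun s => ¬ g⁻¹ • s ∈ T) := by
      ext s
      simp [hS, and_comm]
    have hadd := Finset.card_filter_add_card_filter_not (s := S) (fun s => g⁻¹ • s ∈ T)
    suffices h : ((S.filter (fun s => ¬ g⁻¹ • s ∈ T)).card : ℝ)
        ≤ Fintype.card Ω * (1 - (T.card : ℝ) / Fintype.card Ω) ^ (k + 1) by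
      rw [← hsplit] at h
      convert h
    rcases Nat.eq_zero_or_pos (Fintype.card Ω) with h0 | h0
    · have : IsEmpty Ω := Fintype.card_eq_zero_iff.1 h0
      simp [Finset.eq_empty_of_isEmpty]
    have h0' : (0 : ℝ) < Fintype.card Ω := by exact_mod_cast h0
    have hg' : (S.card : ℝ) * T.card
        ≤ Fintype.card Ω * ((S.filter (fun s => g⁻¹ • s ∈ T)).card : ℝ) := by exact_mod_cast hg
    have hadd' : ((S.filter (fun s => g⁻¹ • s ∈ T)).card : ℝ)
        + ((S.filter (fun s => ¬ g⁻¹ • s ∈ T)).card : ℝ) = S.card := by exact_mod_cast hadd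
    have hT : (T.card : ℝ) / Fintype.card Ω ≤ 1 := by
      rw [div_le_one h0']
      exact_mod_cast Finset.card_le_univ T
    have hq : (S.card : ℝ) * ((T.card : ℝ) / Fintype.card Ω)
        ≤ ((S.filter (fun s => g⁻¹ • s ∈ T)).card : ℝ) := by
      rw [← mul_div_assoc, div_le_iff₀ h0']
      linarith
    calc ((S.filter (fun s => ¬ g⁻¹ • s ∈ T)).card : ℝ)
        ≤ S.card * (1 - (T.card : ℝ) / Fintype.card Ω) := by linarith
      _ ≤ Fintype.card Ω * (1 - (T.card : ℝ) / Fintype.card Ω) ^ k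
            * (1 - (T.card : ℝ) / Fintype.card Ω) :=
          mul_le_mul_of_nonneg_right hS' (by linarith)
      _ = _ := by ring

/-- Enough translates of `T` cover `Ω`. -/
theorem exists_list_translates_cover [Finite G] [Fintype Ω] (T : Finset Ω) (k : ℕ)
    (hk : Fintype.card Ω * Real.log (Fintype.card Ω) < k * T.card) :
    ∃ l : List G, l.length = k ∧ ∀ s : Ω, ∃ g ∈ l, g⁻¹ • s ∈ T := by
  classical
  obtain ⟨l, hl, hb⟩ := exists_list_card_uncovered_le (G := G) T k
  refine ⟨l, hl, fun s => ?_⟩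
  by_contra! hs
  have h0 : (0 : ℝ) < Fintype.card Ω := by exact_mod_cast Fintype.card_pos_iff.2 ⟨s⟩
  have hT : (T.card : ℝ) / Fintype.card Ω ≤ 1 := by
    rw [div_le_one h0]
    exact_mod_cast Finset.card_le_univ T
  have h1 : (1 : ℝ) ≤ (Finset.univ.filter (fun s : Ω => ∀ g ∈ l, g⁻¹ • s ∉ T)).card := by
    exact_mod_cast Finset.card_pos.2 ⟨s, by simpa using hs⟩
  -- By `1 - x ≤ exp (-x)` the number of uncovered points is below `1`, hence zero.
  have h2 : (1 - (T.card : ℝ) / Fintype.card Ω) ^ k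
      ≤ Real.exp (-(k * ((T.card : ℝ) / Fintype.card Ω))) := by
    rw [← mul_neg, Real.exp_nat_mul]
    exact pow_le_pow_left₀ (by linarith) (Real.one_sub_le_exp_neg _) k
  have h3 : Real.log (Fintype.card Ω) < k * ((T.card : ℝ) / Fintype.card Ω) := by
    rw [← mul_div_assoc, lt_div_iff₀ h0]
    linarith
  have h4 : (Fintype.card Ω : ℝ) * Real.exp (-(k * ((T.card : ℝ) / Fintype.card Ω))) < 1 := by
    rw [Real.exp_neg, ← div_eq_mul_inv, div_lt_one (Real.exp_pos _)]
    exact (Real.log_lt_iff_lt_exp h0).1 h3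
  have h5 := mul_le_mul_of_nonneg_left h2 h0.le
  linarith

end Cover

/-! ### Edge automorphisms and covers by images of a rectangle -/

/-- The permutations of the edges that are induced by automorphisms of a bipartite graph. -/
def edgeAutomorphisms {X Y : Type*} (E : Finset (X × Y)) : Subgroup (Equiv.Perm E) where
  carrier := {π | ∃ (σ : Equiv.Perm X) (τ : Equiv.Perm Y),
    ∀ e : E, (π e : X × Y) = (σ e.1.1, τ e.1.2)}
  mul_mem' := by
    rintro π π' ⟨σ, τ, h⟩ ⟨σ', τ', h'⟩
    exact ⟨σ * σ', τ * τ', fun e => by simp [h, h']⟩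
  one_mem' := ⟨1, 1, fun e => by simp⟩
  inv_mem' := by
    rintro π ⟨σ, τ, h⟩
    refine ⟨σ⁻¹, τ⁻¹, fun e => ?_⟩
    have h1 := h (π⁻¹ e)
    rw [show π (π⁻¹ e) = e from π.apply_symm_apply e] at h1
    rw [h1]
    exact Prod.ext (σ.symm_apply_apply _).symm (τ.symm_apply_apply _).symm

theorem IsEdgeTransitive.isPretransitive {X Y : Type*} {E : Finset (X × Y)}
    (hE : IsEdgeTransitive E) : MulAction.IsPretransitive (edgeAutomorphisms E) E where
  exists_smul_eq e e' := by
    obtain ⟨σ, τ, h, he⟩ := hE e.1 e.2 e'.1 e'.2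
    refine ⟨⟨Equiv.Perm.subtypePerm (Equiv.prodCongr σ τ) (fun f => ?_), σ, τ, fun f => rfl⟩, ?_⟩
    · exact h f.1 f.2
    · exact Subtype.ext he

open Classical in
/-- An edge-transitive graph is covered by few automorphic images of a rectangle. -/
theorem IsEdgeTransitive.exists_list_rectangles_cover {X Y : Type*} [Finite X] [Finite Y]
    {E : Finset (X × Y)} (hE : IsEdgeTransitive E) (A : Finset X) (B : Finset Y) (k : ℕ)
    (hk : E.card * Real.log E.card
      < k * (E.filter (fun e => e.1 ∈ A ∧ e.2 ∈ B)).card) :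
    ∃ w : List (Finset X × Finset Y), w.length = k ∧
      (∀ R ∈ w, R.1.card = A.card ∧ R.2.card = B.card) ∧
      ∀ e ∈ E, ∃ R ∈ w, e.1 ∈ R.1 ∧ e.2 ∈ R.2 := by
  have := hE.isPretransitive
  let T : Finset E := Finset.univ.filter (fun e => e.1.1 ∈ A ∧ e.1.2 ∈ B)
  have hT : T.card = (E.filter (fun e => e.1 ∈ A ∧ e.2 ∈ B)).card := by
    rw [← Finset.card_map (Function.Embedding.subtype _)]
    congr 1
    ext e
    simp [T, and_comm, and_assoc]
  obtain ⟨l, hl, hcov⟩ := exists_list_translates_cover (G := edgeAutomorphisms E) T k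
    (by rw [hT]; simpa using hk)
  choose σ τ h using fun g : edgeAutomorphisms E => g.2
  refine ⟨l.map (fun g => (A.map (σ g).toEmbedding, B.map (τ g).toEmbedding)), by simp [hl],
    ?_, fun e he => ?_⟩
  · simp only [List.mem_map]
    rintro R ⟨g, -, rfl⟩
    simp
  · obtain ⟨g, hg, hgT⟩ := hcov ⟨e, he⟩
    refine ⟨_, List.mem_map_of_mem hg, ?_⟩
    -- The edge `g⁻¹ • e` lies in `A × B`, so its image `e` lies in the rectangle moved by `σ g` and
    -- `τ g`.
    have h1 := h g (g⁻¹ • ⟨e, he⟩)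
    have h2 : (g : Equiv.Perm E) (g⁻¹ • (⟨e, he⟩ : E)) = ⟨e, he⟩ := smul_inv_smul g _
    rw [h2] at h1
    simp only [T, Finset.mem_filter, Finset.mem_univ, true_and] at hgT
    have h3 := congrArg Prod.fst h1
    have h4 := congrArg Prod.snd h1
    simp only at h3 h4
    rw [h3, h4]
    simpa using hgT

/-! ### Computability of the codes and of the search -/

/-- An exhaustive search for a witness of a decidable relation is partial computable. -/
theorem exists_partrec_search {α β σ : Type*} [Primcodable α] [Primcodable β] [Primcodable σ]
    {f : α → σ} (hf : Computable f) {P : σ → β → Prop} (hP : PrimrecRel P) :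
    ∃ F : α →. β, Partrec F ∧ ∀ a, (∃ b, P (f a) b) → ∃ b ∈ F a, P (f a) b := by
  classical
  let s : σ → ℕ → Option β := fun x k =>
    (Encodable.decode k : Option β).bind fun b => if P x b then some b else none
  have hs : Primrec₂ s := by
    refine Primrec.option_bind (Primrec.decode.comp Primrec.snd) ?_
    refine Primrec.ite (c := fun q : (σ × ℕ) × β => P q.1.1 q.2) ?_
      (Primrec.option_some.comp Primrec.snd) (Primrec.const none)
    exact hP.comp (Primrec.fst.comp Primrec.fst) Primrec.snd
  refine ⟨fun a => Nat.rfindOpt (s (f a)),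
    Partrec.rfindOpt (hs.to_comp.comp (hf.comp Computable.fst) Computable.snd), fun a h => ?_⟩
  obtain ⟨b, hb⟩ := h
  have hdom : (Nat.rfindOpt (s (f a))).Dom :=
    Nat.rfindOpt_dom.2 ⟨Encodable.encode b, b, by simp [s, hb]⟩
  obtain ⟨b', hb'⟩ := Part.dom_iff_mem.1 hdom
  refine ⟨b', hb', ?_⟩
  obtain ⟨k, hk⟩ := Nat.rfindOpt_spec hb'
  simp only [s, Option.mem_def, Option.bind_eq_some_iff, Option.ite_none_right_eq_some,
    Option.some.injEq] at hk
  obtain ⟨b'', -, h1, rfl⟩ := hk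
  exact h1

/-- The value of a string of binary digits, least significant digit first. -/
def binaryValue (l : List Bool) : ℕ :=
  l.foldr (fun b m => 2 * m + b.toNat) 0

theorem primrec_binaryValue : Primrec binaryValue := by
  refine Primrec.list_foldr (h := fun _ (q : Bool × ℕ) => 2 * q.2 + q.1.toNat)
    Primrec.id (Primrec.const 0) ?_
  exact Primrec.nat_add.comp
    (Primrec.nat_mul.comp (Primrec.const 2) (Primrec.snd.comp Primrec.snd))
    ((Primrec.dom_finite Bool.toNat).comp (Primrec.fst.comp Primrec.snd))

/-- The length is exactly `k`, with padding, so that a decoder that knows `k` can split a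
concatenation. -/
theorem exists_binaryValue_eq (k m : ℕ) (h : m < 2 ^ k) :
    ∃ l : List Bool, l.length = k ∧ binaryValue l = m := by
  induction k generalizing m with
  | zero => exact ⟨[], rfl, by simp at h; simp [binaryValue, h]⟩
  | succ k ih =>
    obtain ⟨l, hl, hv⟩ := ih (m / 2) (by rw [pow_succ] at h; omega)
    refine ⟨m.bodd :: l, by simp [hl], ?_⟩
    have := Nat.bodd_add_div2 m
    rw [Nat.div2_val] at this
    simp only [binaryValue, List.foldr_cons] at hv ⊢
    rw [hv]
    omega

/-- Pairs of numbers have codes whose overhead is twice the length of the first number. -/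
theorem exists_pairDecoder : ∃ D : List Bool → ℕ × ℕ, Computable D ∧
    ∀ k n j m : ℕ, n < 2 ^ k → m < 2 ^ j →
      ∃ p : List Bool, D p = (n, m) ∧ p.length = 2 * k + j + 1 := by
  let idx : List Bool → ℕ := fun p => p.findIdx (fun b => !b)
  have hidx : Primrec idx :=
    Primrec.list_findIdx (f := fun p : List Bool => p) (p := fun _ b => !b) Primrec.id
      (Primrec.not.comp Primrec.snd).to₂
  have hdrop : Primrec fun p : List Bool => p.drop (idx p + 1) :=
    Primrec.list_drop.comp (Primrec.succ.comp hidx) Primrec.id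
  refine ⟨fun p => (binaryValue ((p.drop (idx p + 1)).take (idx p)),
    binaryValue ((p.drop (idx p + 1)).drop (idx p))), ?_, ?_⟩
  · exact (Primrec.pair (primrec_binaryValue.comp (Primrec.list_take.comp hidx hdrop))
      (primrec_binaryValue.comp (Primrec.list_drop.comp hidx hdrop))).to_comp
  · intro k n j m hn hm
    obtain ⟨l, hl, hlv⟩ := exists_binaryValue_eq k n hn
    obtain ⟨r, hr, hrv⟩ := exists_binaryValue_eq j m hm
    -- The code is `1^k 0 l r`: the unary prefix tells where `l` ends, and `r` takes the rest of the
    -- string.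
    refine ⟨List.replicate k true ++ false :: (l ++ r), ?_, by simp [hl, hr]; omega⟩
    have h1 : idx (List.replicate k true ++ false :: (l ++ r)) = k := by
      have h0 : ∀ (i : ℕ) (s : List Bool),
          (List.replicate i true ++ false :: s).findIdx (fun b => !b) = i := by
        intro i s
        induction i with
        | zero => simp [List.findIdx_cons]
        | succ i ih => simp [List.replicate_succ, List.findIdx_cons, ih]
      exact h0 _ _
    have h2 : (List.replicate k true ++ false :: (l ++ r)).drop (k + 1) = l ++ r := by
      simp [List.drop_append]
    simp only [h1, h2]
    rw [List.take_left' hl, List.drop_left' hl, hlv, hrv]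

/-- A rectangle, given by the lists of the elements of its sides. -/
abbrev ListRectangle := List (List Bool) × List (List Bool)

/-- The rectangles `w` cover all the edges in `p.1`, their number is at most `p.2.1`, and the
lengths of their sides are at most `p.2.2.1` and `p.2.2.2`. -/
def IsListCover (p : List (List Bool × List Bool) × ℕ × ℕ × ℕ) (w : List ListRectangle) : Prop :=
  w.length ≤ p.2.1 ∧ (∀ R ∈ w, R.1.length ≤ p.2.2.1 ∧ R.2.length ≤ p.2.2.2) ∧
    ∀ e ∈ p.1, ∃ R ∈ w, e.1 ∈ R.1 ∧ e.2 ∈ R.2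

theorem primrecRel_mem_list {α : Type*} [Primcodable α] :
    PrimrecRel fun (a : α) (l : List α) => a ∈ l := by
  have h : PrimrecRel fun (l : List α) (a : α) => ∃ b ∈ l, b = a :=
    PrimrecRel.exists_mem_list Primrec.eq
  exact (h.comp Primrec.snd Primrec.fst).of_eq fun _ => by simp

theorem primrecRel_isListCover : PrimrecRel IsListCover := by
  have h1 : PrimrecPred fun q : (List (List Bool × List Bool) × ℕ × ℕ × ℕ) × List ListRectangle =>
      q.2.length ≤ q.1.2.1 :=
    Primrec.nat_le.comp (Primrec.list_length.comp Primrec.snd)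
      (Primrec.fst.comp (Primrec.snd.comp Primrec.fst))
  have h2 : PrimrecRel fun (R : ListRectangle) (s : ℕ × ℕ) =>
      R.1.length ≤ s.1 ∧ R.2.length ≤ s.2 :=
    PrimrecPred.and
      (Primrec.nat_le.comp (Primrec.list_length.comp (Primrec.fst.comp Primrec.fst))
        (Primrec.fst.comp Primrec.snd))
      (Primrec.nat_le.comp (Primrec.list_length.comp (Primrec.snd.comp Primrec.fst))
        (Primrec.snd.comp Primrec.snd))
  have h3 : PrimrecRel fun (R : ListRectangle) (e : List Bool × List Bool) =>
      e.1 ∈ R.1 ∧ e.2 ∈ R.2 :=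
    PrimrecPred.and
      (primrecRel_mem_list.comp (Primrec.fst.comp Primrec.snd) (Primrec.fst.comp Primrec.fst))
      (primrecRel_mem_list.comp (Primrec.snd.comp Primrec.snd) (Primrec.snd.comp Primrec.fst))
  have h4 : PrimrecRel fun (e : List Bool × List Bool) (w : List ListRectangle) =>
      ∃ R ∈ w, e.1 ∈ R.1 ∧ e.2 ∈ R.2 :=
    h3.exists_mem_list.comp Primrec.snd Primrec.fst
  exact h1.and ((h2.forall_mem_list.comp Primrec.snd
    (Primrec.snd.comp (Primrec.snd.comp Primrec.fst))).and
    (h4.forall_mem_list.comp (Primrec.fst.comp Primrec.fst) Primrec.snd))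

/-! ### Computable rounding of the exponents -/

/-- An upper bound for `q * n` with `q` rational that is computable and sharp up to `1`. -/
def ratMulBound (q : ℚ) (n : ℕ) : ℕ := q.num.toNat * n / q.den + 1

theorem primrec_ratMulBound (q : ℚ) : Primrec (ratMulBound q) :=
  Primrec.succ.comp (Primrec.nat_div.comp
    (Primrec.nat_mul.comp (Primrec.const _) Primrec.id) (Primrec.const _))

theorem primrec_two_pow : Primrec fun n : ℕ => 2 ^ n := by
  refine (Primrec.nat_rec₁ (f := fun _ m => 2 * m) 1
    (Primrec.nat_mul.comp (Primrec.const 2) Primrec.snd)).of_eq fun n => ?_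
  induction n with
  | zero => rfl
  | succ n ih => rw [pow_succ, ← ih, mul_comm]

theorem mul_le_ratMulBound {q : ℚ} (hq : 0 < q) (n : ℕ) : (q : ℝ) * n ≤ ratMulBound q n := by
  have hden : (0 : ℝ) < q.den := by exact_mod_cast q.den_pos
  have hnum : ((q.num.toNat : ℕ) : ℝ) = q.num := by
    exact_mod_cast congrArg (Int.cast : ℤ → ℝ) (Int.toNat_of_nonneg (Rat.num_pos.2 hq).le)
  have h : (q.num.toNat * n : ℕ) < (q.num.toNat * n / q.den + 1) * q.den :=
    Nat.lt_mul_of_div_lt (Nat.lt_succ_self _) q.den_pos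
  have h' : ((q.num.toNat : ℕ) : ℝ) * n < ratMulBound q n * q.den := by
    exact_mod_cast h
  rw [hnum] at h'
  rw [Rat.cast_def, div_mul_eq_mul_div, div_le_iff₀ hden]
  exact h'.le

theorem ratMulBound_le {q : ℚ} (hq : 0 < q) (n : ℕ) : (ratMulBound q n : ℝ) ≤ q * n + 1 := by
  have hden : (0 : ℝ) < q.den := by exact_mod_cast q.den_pos
  have hnum : ((q.num.toNat : ℕ) : ℝ) = q.num := by
    exact_mod_cast congrArg (Int.cast : ℤ → ℝ) (Int.toNat_of_nonneg (Rat.num_pos.2 hq).le)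
  have h : (((q.num.toNat * n / q.den : ℕ)) : ℝ) ≤ ((q.num.toNat * n : ℕ) : ℝ) / q.den :=
    Nat.cast_div_le
  rw [Nat.cast_mul, hnum] at h
  rw [ratMulBound, Nat.cast_add, Nat.cast_one, Rat.cast_def, div_mul_eq_mul_div]
  linarith

/-! ### Counting objects of small complexity -/

theorem card_le_two_pow_of_length_lt {α : Type*} (S : Finset α) (f : α → List Bool)
    (hf : Set.InjOn f S) (m : ℕ) (h : ∀ s ∈ S, (f s).length < m) : S.card ≤ 2 ^ m := by
  classical
  let T : Finset (List Bool) := (Finset.univ : Finset (Σ i : Fin m, List.Vector Bool i)).image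
    (fun v => v.2.toList)
  have h1 : S.card ≤ T.card := by
    refine Finset.card_le_card_of_injOn f (fun s hs => ?_) hf
    simp only [T, Finset.coe_image, Set.mem_image]
    exact ⟨⟨⟨(f s).length, h s hs⟩, ⟨f s, rfl⟩⟩, by simp, rfl⟩
  refine h1.trans (Finset.card_image_le.trans ?_)
  rw [Finset.card_univ, Fintype.card_sigma]
  simp only [card_vector, Fintype.card_bool]
  rw [Fin.sum_univ_eq_sum_range (fun i => 2 ^ i) m, Nat.geomSum_eq le_rfl]
  simp

/-- Fewer than `2 ^ (t + 1)` objects have complexity less than `t`. -/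
theorem IsOptimalDecompressor.card_le_of_condComplexity_lt {U : List Bool → List Bool →. List Bool}
    (hU : IsOptimalDecompressor U) {α : Type*} (S : Finset α) (f : α → List Bool)
    (hf : Function.Injective f) (y : List Bool) (t : ℝ)
    (h : ∀ s ∈ S, (condComplexity U (f s) y : ℝ) < t) : (S.card : ℝ) ≤ 2 ^ (t + 1) := by
  rcases S.eq_empty_or_nonempty with rfl | ⟨s₀, hs₀⟩
  · simpa using (Real.rpow_pos_of_pos two_pos _).le
  choose p hp hl using fun s : α => hU.exists_program (f s) y
  -- Nonemptiness of `S` forces `t ≥ 0`, without which `⌈t⌉₊ < t + 1` may fail.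
  have ht : 0 ≤ t := (Nat.cast_nonneg _).trans (h s₀ hs₀).le
  have h1 : S.card ≤ 2 ^ ⌈t⌉₊ := by
    refine card_le_two_pow_of_length_lt S p (fun a _ b _ hab => hf ?_) _ fun s hs => ?_
    · have ha := hp a
      rw [hab] at ha
      exact Part.mem_unique ha (hp b)
    · rw [hl]
      exact Nat.lt_ceil.2 (h s hs)
  calc (S.card : ℝ) ≤ (2 : ℝ) ^ ((⌈t⌉₊ : ℕ) : ℝ) := by
        rw [Real.rpow_natCast]; exact_mod_cast h1
    _ ≤ 2 ^ (t + 1) :=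
        Real.rpow_le_rpow_of_exponent_le one_le_two (Nat.ceil_lt_add_one ht).le

open Classical in
theorem card_filter_le_maxEdgesInRectangle {X Y : Type*} [Fintype X] [Fintype Y]
    (E : Finset (X × Y)) {a b : ℝ} (A : Finset X) (B : Finset Y)
    (hA : (A.card : ℝ) ≤ 2 ^ a) (hB : (B.card : ℝ) ≤ 2 ^ b) :
    (E.filter (fun e => e.1 ∈ A ∧ e.2 ∈ B)).card ≤ maxEdgesInRectangle E a b := by
  unfold maxEdgesInRectangle
  refine le_trans (le_of_eq ?_) (Finset.le_sup (b := (A, B)) (by simp [hA, hB]))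
  rfl

open Classical in
theorem exists_card_filter_eq_maxEdgesInRectangle {X Y : Type*} [Fintype X] [Fintype Y]
    (E : Finset (X × Y)) (a b : ℝ) : ∃ (A : Finset X) (B : Finset Y),
    (A.card : ℝ) ≤ 2 ^ a ∧ (B.card : ℝ) ≤ 2 ^ b ∧
    (E.filter (fun e => e.1 ∈ A ∧ e.2 ∈ B)).card = maxEdgesInRectangle E a b := by
  obtain ⟨R, hR, h⟩ := Finset.exists_mem_eq_sup
    ((Finset.univ : Finset (Finset X × Finset Y)).filter
      (fun R => (R.1.card : ℝ) ≤ (2 : ℝ) ^ a ∧ (R.2.card : ℝ) ≤ (2 : ℝ) ^ b))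
    ⟨(∅, ∅), by simp [(Real.rpow_pos_of_pos two_pos _).le]⟩
    (fun R => (E.filter (fun e => e.1 ∈ R.1 ∧ e.2 ∈ R.2)).card)
  simp only [Finset.mem_filter, Finset.mem_univ, true_and] at hR
  exact ⟨R.1, R.2, hR.1, hR.2, h.symm⟩

open Classical in
/-- If rectangles contain few edges, then few edges have a string `c` that is simple and makes both
ends simple. -/
theorem IsOptimalDecompressor.card_edges_le {U : List Bool → List Bool →. List Bool}
    (hU : IsOptimalDecompressor U) {n : ℕ} (E : Finset (List.Vector Bool n × List.Vector Bool n))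
    (a b g s : ℝ) (hs : 1 ≤ s) :
    ((E.filter (fun e => ∃ c : List Bool, (plainComplexity U c : ℝ) < g - s ∧
        (condComplexity U e.1.toList c : ℝ) < a - s ∧
        (condComplexity U e.2.toList c : ℝ) < b - s)).card : ℝ)
      ≤ maxEdgesInRectangle E a b * 2 ^ g * 2 ^ (1 - s) := by
  set B := E.filter (fun e => ∃ c : List Bool, (plainComplexity U c : ℝ) < g - s ∧
        (condComplexity U e.1.toList c : ℝ) < a - s ∧
        (condComplexity U e.2.toList c : ℝ) < b - s) with hB
  have hex : ∀ e : List.Vector Bool n × List.Vector Bool n, ∃ c : List Bool, e ∈ B →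
      (plainComplexity U c : ℝ) < g - s ∧ (condComplexity U e.1.toList c : ℝ) < a - s ∧
        (condComplexity U e.2.toList c : ℝ) < b - s := by
    intro e
    by_cases he : e ∈ B
    · obtain ⟨c, hc⟩ := (Finset.mem_filter.1 he).2
      exact ⟨c, fun _ => hc⟩
    · exact ⟨[], fun h => absurd h he⟩
  -- One witness `c e` is fixed for each bad edge; the bad edges are then counted by the fibres of
  -- `c`, each inside one rectangle.
  choose c hc using hex
  have hcard : ((B.image c).card : ℝ) ≤ 2 ^ (g - s + 1) := by
    refine hU.card_le_of_condComplexity_lt _ id Function.injective_id [] _ fun z hz => ?_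
    obtain ⟨e, he, rfl⟩ := Finset.mem_image.1 hz
    exact (hc e he).1
  have hinj : Function.Injective (List.Vector.toList : List.Vector Bool n → List Bool) :=
    List.Vector.toList_injective
  -- The hypothesis `1 ≤ s` absorbs the `+ 1` in the exponent of the counting bound.
  have hside : ∀ (t : ℝ) (z : List Bool), ((Finset.univ.filter
      (fun v : List.Vector Bool n => (condComplexity U v.toList z : ℝ) < t - s)).card : ℝ)
      ≤ 2 ^ t := fun t z =>
    (hU.card_le_of_condComplexity_lt _ _ hinj z (t - s) fun v hv =>
      (Finset.mem_filter.1 hv).2).trans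
      (Real.rpow_le_rpow_of_exponent_le one_le_two (by linarith))
  have hfib : B.card ≤ maxEdgesInRectangle E a b * (B.image c).card := by
    refine Finset.card_le_mul_card_image B _ fun z _ => ?_
    refine le_trans (Finset.card_le_card fun e he => ?_)
      (card_filter_le_maxEdgesInRectangle E _ _ (hside a z) (hside b z))
    obtain ⟨heB, rfl⟩ := Finset.mem_filter.1 he
    have := hc e heB
    simp [(Finset.mem_filter.1 heB).1, this.2.1, this.2.2]
  calc (B.card : ℝ) ≤ maxEdgesInRectangle E a b * (B.image c).card := by exact_mod_cast hfib
    _ ≤ maxEdgesInRectangle E a b * 2 ^ (g - s + 1) :=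
        mul_le_mul_of_nonneg_left hcard (Nat.cast_nonneg _)
    _ = _ := by
        rw [mul_assoc, ← Real.rpow_add two_pos]
        congr 2
        ring

/-! ### Upper bounds for complexity -/

theorem IsOptimalDecompressor.exists_condComplexity_le {U V : List Bool → List Bool →. List Bool}
    (hU : IsOptimalDecompressor U) (hV : Partrec₂ V) :
    ∃ k : ℕ, ∀ p y x : List Bool, x ∈ V p y → condComplexity U x y ≤ p.length + k := by
  obtain ⟨k, hk⟩ := hU.2 V hV
  refine ⟨k, fun p y x h => ?_⟩
  obtain ⟨q, hq, hl⟩ := hk p y x h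
  exact (Nat.sInf_le (s := {l : ℕ | ∃ p : List Bool, x ∈ U p y ∧ p.length = l})
    ⟨q, hq, rfl⟩).trans hl

/-- The string that encodes a rectangle, in unary. -/
def rectangleCode (R : ListRectangle) : List Bool :=
  List.replicate (Encodable.encode R) true

theorem computable_rectangleCode : Computable rectangleCode := by
  have h : Primrec fun n : ℕ => List.replicate n true := by
    refine (Primrec.nat_rec₁ (f := fun _ l => true :: l) []
      (Primrec.list_cons.comp (Primrec.const true) Primrec.snd)).of_eq fun n => ?_
    induction n with
    | zero => rfl
    | succ n ih => rw [List.replicate_succ, ← ih]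
  exact (h.comp Primrec.encode).to_comp

/-- Given the code of a rectangle, an element of one of its sides is described by its position. -/
theorem IsOptimalDecompressor.exists_condComplexity_rectangleCode_le
    {U : List Bool → List Bool →. List Bool} (hU : IsOptimalDecompressor U)
    {side : ListRectangle → List (List Bool)} (hside : Primrec side) :
    ∃ k : ℕ, ∀ (R : ListRectangle) (x : List Bool) (m : ℕ), x ∈ side R →
      (side R).length ≤ 2 ^ m → condComplexity U x (rectangleCode R) ≤ m + k := by
  -- The condition is unary, so its length is the number that encodes the rectangle; the program is
  -- a position in the side.
  let V : List Bool → List Bool → Option (List Bool) := fun p c =>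
    (Encodable.decode c.length : Option ListRectangle).bind
      fun R => (side R)[binaryValue p]?
  have hV : Primrec₂ V := by
    refine Primrec.option_bind (Primrec.decode.comp (Primrec.list_length.comp Primrec.snd)) ?_
    exact Primrec.list_getElem?.comp (hside.comp Primrec.snd)
      (primrec_binaryValue.comp (Primrec.fst.comp Primrec.fst))
  obtain ⟨k, hk⟩ := hU.exists_condComplexity_le
    (V := fun p c => (V p c : Part (List Bool))) (Computable.ofOption hV.to_comp)
  refine ⟨k, fun R x m hx hm => ?_⟩
  obtain ⟨i, hi, hix⟩ := List.getElem_of_mem hx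
  obtain ⟨p, hp, hpi⟩ := exists_binaryValue_eq m i (hi.trans_le hm)
  rw [← hp]
  refine hk p _ x ?_
  simp only [V, rectangleCode, List.length_replicate, Encodable.encodek, Option.bind_some, hpi]
  simp [hi, hix]

/-- A computable family of graphs with a small cover by rectangles has one whose elements are
described by `n` and their position in the cover. -/
theorem IsOptimalDecompressor.exists_plainComplexity_rectangleCode_le
    {U : List Bool → List Bool →. List Bool} (hU : IsOptimalDecompressor U)
    {L : ℕ → List (List Bool × List Bool)} (hL : Computable L) {K a b : ℕ → ℕ}
    (hK : Computable K) (ha : Computable a) (hb : Computable b) :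
    ∃ k : ℕ, ∀ n i j : ℕ, (∃ w, IsListCover (L n, K n, a n, b n) w) → n < 2 ^ i → K n ≤ 2 ^ j →
      ∀ e ∈ L n, ∃ R : ListRectangle, e.1 ∈ R.1 ∧ e.2 ∈ R.2 ∧ R.1.length ≤ a n ∧
        R.2.length ≤ b n ∧ plainComplexity U (rectangleCode R) ≤ 2 * i + j + 1 + k := by
  obtain ⟨F, hF, hFspec⟩ := exists_partrec_search
    (hL.pair (hK.pair (ha.pair hb))) primrecRel_isListCover
  obtain ⟨D, hD, hDspec⟩ := exists_pairDecoder
  -- The program encodes `n` and a position; the search depends on `n` only, so all positions refer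
  -- to the same cover.
  let V : List Bool → List Bool →. List Bool := fun p _ =>
    (F (D p).1).bind fun w => ((w[(D p).2]?.map rectangleCode : Option (List Bool)) : Part _)
  have hV : Partrec₂ V := by
    refine Partrec.bind (hF.comp (Computable.fst.comp (hD.comp Computable.fst))) ?_
    refine Computable.ofOption (Computable.option_map ?_ (computable_rectangleCode.comp Computable.snd))
    exact Computable.list_getElem?.comp Computable.snd
      (Computable.snd.comp (hD.comp (Computable.fst.comp Computable.fst)))
  obtain ⟨k, hk⟩ := hU.exists_condComplexity_le hV
  refine ⟨k, fun n i j hw hi hj e he => ?_⟩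
  obtain ⟨w, hwF, hlen, hsize, hcov⟩ := hFspec n hw
  obtain ⟨R, hR, h1, h2⟩ := hcov e he
  obtain ⟨m, hm, hmR⟩ := List.getElem_of_mem hR
  obtain ⟨p, hp, hpl⟩ := hDspec i n j m hi (hm.trans_le (hlen.trans hj))
  refine ⟨R, h1, h2, (hsize R hR).1, (hsize R hR).2, ?_⟩
  rw [← hpl]
  refine hk p [] _ ?_
  simp only [V, hp, Part.mem_bind_iff]
  exact ⟨w, hwF, by simp [hm, hmR]⟩

/-! ### Covers of edge-transitive graphs and the main theorem -/

-- A rectangle attaining the maximum has at least `|E| / 2 ^ g` edges, so `2 ^ g'` translates times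
-- a factor above `ln |E|` suffice; `2 * n` is such a factor.
open Classical in
theorem IsEdgeTransitive.exists_isListCover {n : ℕ}
    {E : Finset (List.Vector Bool n × List.Vector Bool n)} (hE : IsEdgeTransitive E)
    {L : List (List Bool × List Bool)}
    (hL : ∀ p, p ∈ L → ∃ e ∈ E, p = (e.1.toList, e.2.toList)) {a b g : ℝ} {a' b' g' : ℕ}
    (ha : a ≤ a') (hb : b ≤ b') (hg : g ≤ g') (hn : 0 < n) (hne : E.Nonempty)
    (h : (E.card : ℝ) ≤ maxEdgesInRectangle E a b * 2 ^ g) :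
    ∃ w, IsListCover (L, 2 ^ g' * (2 * n), 2 ^ a', 2 ^ b') w := by
  obtain ⟨A, B, hA, hB, hAB⟩ := exists_card_filter_eq_maxEdgesInRectangle E a b
  have h0 : (0 : ℝ) < E.card := by exact_mod_cast hne.card_pos
  have hcast : ∀ {m : ℕ} {t : ℝ} {t' : ℕ}, (m : ℝ) ≤ 2 ^ t → t ≤ t' → m ≤ 2 ^ t' := by
    intro m t t' hm ht
    have h1 : (m : ℝ) ≤ 2 ^ (t' : ℝ) :=
      hm.trans (Real.rpow_le_rpow_of_exponent_le one_le_two ht)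
    rw [Real.rpow_natCast] at h1
    exact_mod_cast h1
  have hlog : Real.log E.card < 2 * n := by
    have h1 : E.card ≤ 2 ^ n * 2 ^ n := by
      simpa using Finset.card_le_univ E
    have h2 : (E.card : ℝ) ≤ 2 ^ (2 * n) := by
      rw [two_mul, pow_add]; exact_mod_cast h1
    have h3 := Real.log_le_log h0 h2
    rw [Real.log_pow] at h3
    have h4 : (0 : ℝ) < n := by exact_mod_cast hn
    -- Strictness comes from `ln 2 < 1` and `n > 0`.
    have h5 := Real.log_two_lt_d9
    push_cast at h3
    nlinarith
  obtain ⟨w, hwl, hw, hcov⟩ := hE.exists_list_rectangles_cover A B (2 ^ g' * (2 * n)) (by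
    rw [hAB]
    have h1 : (2 : ℝ) ^ g ≤ 2 ^ g' := by
      rw [← Real.rpow_natCast]
      exact Real.rpow_le_rpow_of_exponent_le one_le_two hg
    have h2 : (E.card : ℝ) ≤ maxEdgesInRectangle E a b * 2 ^ g' :=
      h.trans (mul_le_mul_of_nonneg_left h1 (Nat.cast_nonneg _))
    have h3 : (0 : ℝ) < 2 * n := by positivity
    push_cast
    calc (E.card : ℝ) * Real.log E.card < E.card * (2 * n) := mul_lt_mul_of_pos_left hlog h0
      _ ≤ maxEdgesInRectangle E a b * 2 ^ g' * (2 * n) := mul_le_mul_of_nonneg_right h2 h3.le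
      _ = _ := by ring)
  refine ⟨w.map fun R => (R.1.toList.map List.Vector.toList, R.2.toList.map List.Vector.toList),
    by simp [hwl], ?_, ?_⟩
  · simp only [List.mem_map]
    rintro _ ⟨R, hR, rfl⟩
    simp only [List.length_map, Finset.length_toList]
    rw [(hw R hR).1, (hw R hR).2]
    exact ⟨hcast hA ha, hcast hB hb⟩
  · intro p hp
    obtain ⟨e, he, rfl⟩ := hL p hp
    obtain ⟨R, hR, h1, h2⟩ := hcov e he
    exact ⟨_, List.mem_map_of_mem hR, List.mem_map_of_mem (Finset.mem_toList.2 h1),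
      List.mem_map_of_mem (Finset.mem_toList.2 h2)⟩

open Classical in
theorem mainTheorem8
    (U : List Bool → List Bool →. List Bool) (hU : IsOptimalDecompressor U)
    (E : (n : ℕ) → Finset (List.Vector Bool n × List.Vector Bool n))
    (hE : IsComputableGraphFamily E)
    (α β γ : ℚ) (hα : 0 < α) (hβ : 0 < β) (hγ : 0 < γ) :
    ∃ d : ℝ, 0 < d ∧
      (∀ ε : ℝ, 0 < ε → ∃ N : ℕ, ∀ n : ℕ, N ≤ n →
        (maxEdgesInRectangle (E n) (α * n) (β * n) : ℝ) * (2 : ℝ) ^ ((γ : ℝ) * n)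
            ≤ ((E n).card : ℝ) →
          (((E n).filter (fun e => ∃ c : List Bool,
              (plainComplexity U c : ℝ) < γ * n - d * Real.logb 2 n ∧
              (condComplexity U e.1.toList c : ℝ) < α * n - d * Real.logb 2 n ∧
              (condComplexity U e.2.toList c : ℝ) < β * n - d * Real.logb 2 n)).card : ℝ)
            ≤ ε * ((E n).card : ℝ)) ∧
      (∃ N : ℕ, ∀ n : ℕ, N ≤ n → IsEdgeTransitive (E n) →
        ((E n).card : ℝ)
            ≤ (maxEdgesInRectangle (E n) (α * n) (β * n) : ℝ) * (2 : ℝ) ^ ((γ : ℝ) * n) →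
          ∀ e ∈ E n, ∃ c : List Bool,
            (plainComplexity U c : ℝ) < γ * n + d * Real.logb 2 n ∧
            (condComplexity U e.1.toList c : ℝ) < α * n + d * Real.logb 2 n ∧
            (condComplexity U e.2.toList c : ℝ) < β * n + d * Real.logb 2 n) := by
  obtain ⟨L, hLc, hL⟩ := hE
  -- Rationality of the exponents is used here: the bounds passed to the search must be computable
  -- from `n`.
  have hcomp : ∀ q : ℚ, Computable fun n => 2 ^ ratMulBound q n := fun q =>
    (primrec_two_pow.comp (primrec_ratMulBound q)).to_comp
  obtain ⟨k₀, hk₀⟩ := hU.exists_plainComplexity_rectangleCode_le hLc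
    (K := fun n => 2 ^ ratMulBound γ n * (2 * n))
    (Primrec.nat_mul.to_comp.comp (hcomp γ)
      (Primrec.nat_mul.comp (Primrec.const 2) Primrec.id).to_comp) (hcomp α) (hcomp β)
  obtain ⟨k₁, hk₁⟩ := hU.exists_condComplexity_rectangleCode_le
    (side := Prod.fst) Primrec.fst
  obtain ⟨k₂, hk₂⟩ := hU.exists_condComplexity_rectangleCode_le
    (side := Prod.snd) Primrec.snd
  have hlog1 : ∀ n : ℕ, 2 ≤ n → 1 ≤ Real.logb 2 n := fun n hn => by
    rw [Real.le_logb_iff_rpow_le one_lt_two (by positivity), Real.rpow_one]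
    exact_mod_cast hn
  -- In (2) the overhead of `c` is at most `3 log n + 6 + k₀`, below `(k₀ + 10) log n` since `log n
  -- ≥ 1` for `n ≥ 2`; `k₁` and `k₂` serve the two ends. Part (1) needs only `d ≥ 1`, which makes
  -- the bad fraction at most `2 / n`.
  refine ⟨k₀ + k₁ + k₂ + 10, by positivity, fun ε hε => ?_, 2, fun n hn hT hR e he => ?_⟩
  · obtain ⟨M, hM⟩ := exists_nat_gt (2 / ε)
    refine ⟨max M 2, fun n hn hR => ?_⟩
    have hn2 : 2 ≤ n := (le_max_right _ _).trans hn
    have hnM : (M : ℝ) ≤ n := by exact_mod_cast (le_max_left _ _).trans hn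
    have hn0 : (0 : ℝ) < n := by positivity
    have hl := hlog1 n hn2
    have hd : Real.logb 2 n ≤ (k₀ + k₁ + k₂ + 10) * Real.logb 2 n := by
      have : (0 : ℝ) ≤ k₀ + k₁ + k₂ + 9 := by positivity
      nlinarith
    refine (hU.card_edges_le (E n) (α * n) (β * n) (γ * n)
      ((k₀ + k₁ + k₂ + 10) * Real.logb 2 n) (hl.trans hd)).trans ?_
    have h1 : (2 : ℝ) ^ (1 - (k₀ + k₁ + k₂ + 10) * Real.logb 2 n) ≤ ε := by
      calc (2 : ℝ) ^ (1 - (k₀ + k₁ + k₂ + 10) * Real.logb 2 n)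
          ≤ 2 ^ (1 - Real.logb 2 n) :=
            Real.rpow_le_rpow_of_exponent_le one_le_two (by linarith)
        _ = 2 / n := by
            rw [Real.rpow_sub two_pos, Real.rpow_one,
              Real.rpow_logb two_pos (by norm_num) hn0]
        _ ≤ ε := by
            rw [div_le_iff₀ hn0, mul_comm, ← div_le_iff₀ hε]
            exact hM.le.trans hnM
    calc _ ≤ ((E n).card : ℝ) * ε :=
          mul_le_mul hR h1 (Real.rpow_pos_of_pos two_pos _).le (Nat.cast_nonneg _)
      _ = _ := mul_comm _ _
  · have hl := hlog1 n hn
    have hlogn : (Nat.log 2 n : ℝ) ≤ Real.logb 2 n := by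
      exact_mod_cast Real.natLog_le_logb n 2
    have hsize : n < 2 ^ (Nat.log 2 n + 1) := Nat.lt_pow_succ_log_self one_lt_two n
    obtain ⟨R, h1, h2, hR1, hR2, hc⟩ := hk₀ n (Nat.log 2 n + 1)
      (ratMulBound γ n + (Nat.log 2 n + 1 + 1))
      (hT.exists_isListCover (fun p hp => (hL n p).1 hp) (mul_le_ratMulBound hα n)
        (mul_le_ratMulBound hβ n) (mul_le_ratMulBound hγ n) (by omega) ⟨e, he⟩ hR)
      hsize
      -- The factor `2 * n` is at most `2 ^ (Nat.log 2 n + 2)`.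
      (by
        rw [pow_add]
        refine Nat.mul_le_mul_left _ ?_
        rw [pow_succ _ (Nat.log 2 n + 1)]
        omega)
      (e.1.toList, e.2.toList) ((hL n _).2 ⟨e, he, rfl⟩)
    have hx := hk₁ R _ _ h1 hR1
    have hy := hk₂ R _ _ h2 hR2
    have hc' : (plainComplexity U (rectangleCode R) : ℝ) ≤ 2 * (Nat.log 2 n + 1)
        + (ratMulBound γ n + (Nat.log 2 n + 1 + 1)) + 1 + k₀ := by exact_mod_cast hc
    have hx' : (condComplexity U e.1.toList (rectangleCode R) : ℝ)
        ≤ ratMulBound α n + k₁ := by exact_mod_cast hx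
    have hy' : (condComplexity U e.2.toList (rectangleCode R) : ℝ)
        ≤ ratMulBound β n + k₂ := by exact_mod_cast hy
    have hbα := ratMulBound_le hα n
    have hbβ := ratMulBound_le hβ n
    have hbγ := ratMulBound_le hγ n
    have e0 := le_mul_of_one_le_right (Nat.cast_nonneg (α := ℝ) k₀) hl
    have e1 := le_mul_of_one_le_right (Nat.cast_nonneg (α := ℝ) k₁) hl
    have e2 := le_mul_of_one_le_right (Nat.cast_nonneg (α := ℝ) k₂) hl
    have p0 := Nat.cast_nonneg (α := ℝ) k₀
    have p1 := Nat.cast_nonneg (α := ℝ) k₁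
    have p2 := Nat.cast_nonneg (α := ℝ) k₂
    refine ⟨rectangleCode R, ?_, ?_, ?_⟩ <;> linarith
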